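/- Theorem (Ramanujan's ellipse). Let $a>0$ be the semimajor axis of an ellipse in the Euclidean plane whose eccentricity is $\sin\frac{\pi}{12}=\sin 15^\circ$. Then the perimeter (arc length) $p$ of the ellipse is $$ p = a\,\sqrt{\frac{\pi}{\sqrt{3}}}\,\Biggl\{\biggl(1+\frac{1}{\sqrt{3}}\biggr)\frac{\Gamma(\frac13)}{\Gamma(\frac56)}+\frac{2\,\Gamma(\frac56)}{\Gamma(\frac13)}\Biggr\}, $$ where $\Gamma(x)=\int_0^\infty t^{x-1}e^{-t}\,dt$ is the gamma function. -/

import Mathlib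

/-- The Euclidean plane. -/
abbrev EuclideanPlane : Type := EuclideanSpace ℝ (Fin 2)

/-- A (non-degenerate) ellipse in the Euclidean plane, in arbitrary position: its center, the
orthonormal directions of its major axis (index `0`) and of its minor axis (index `1`), its
semimajor axis and its semiminor axis. -/
structure PlaneEllipse where
  center : EuclideanPlane
  axes : OrthonormalBasis (Fin 2) ℝ EuclideanPlane
  semimajor : ℝ
  semiminor : ℝ
  semiminor_pos : 0 < semiminor
  semiminor_le : semiminor ≤ semimajor

/-- The points of the ellipse: `x ^ 2 / a ^ 2 + y ^ 2 / b ^ 2 = 1` in the coordinates `x`, `y`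
with respect to its center and axes. -/
def PlaneEllipse.curve (E : PlaneEllipse) : Set EuclideanPlane :=
  {P | (E.axes.repr (P - E.center) 0) ^ 2 / E.semimajor ^ 2 +
       (E.axes.repr (P - E.center) 1) ^ 2 / E.semiminor ^ 2 = 1}

/-- The eccentricity `√(1 - b ^ 2 / a ^ 2)`. -/
noncomputable def PlaneEllipse.eccentricity (E : PlaneEllipse) : ℝ :=
  Real.sqrt (1 - E.semiminor ^ 2 / E.semimajor ^ 2)

/-- `γ`, restricted to `[0, 1]`, is a continuous parametrization of `S` as a simple closed curve,
traversed exactly once. -/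
structure IsSimpleClosedParam (γ : ℝ → EuclideanPlane) (S : Set EuclideanPlane) : Prop where
  continuousOn : ContinuousOn γ (Set.Icc 0 1)
  closed : γ 0 = γ 1
  injOn : Set.InjOn γ (Set.Ico 0 1)
  image_eq : γ '' Set.Icc 0 1 = S

/-- `S` is a rectifiable simple closed curve with perimeter `p`: it has a parametrization as a
simple closed curve, and for each such parametrization the arc length, that is, the supremum of
the lengths of the inscribed polygonal paths, is finite and equal to `p`. -/
def HasPerimeter (S : Set EuclideanPlane) (p : ℝ) : Prop :=
  (∃ γ : ℝ → EuclideanPlane, IsSimpleClosedParam γ S) ∧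
  ∀ γ : ℝ → EuclideanPlane, IsSimpleClosedParam γ S →
    eVariationOn γ (Set.Icc 0 1) ≠ ⊤ ∧ (eVariationOn γ (Set.Icc 0 1)).toReal = p

/-!
The perimeter of an ellipse with semimajor axis `a` and eccentricity `e` is
`∫ t in 0..2π, a * √(1 - e ^ 2 * sin t ^ 2)`, and for `e = sin (π / 12)` this complete elliptic
integral of the second kind reduces to two beta integrals.

For the geometric part, the length of a `C¹` curve is the integral of its speed
(`eVariationOn_Icc_eq_of_hasDerivAt`). An arbitrary parametrization of the ellipse as a simple
closed curve lifts through the covering `ℝ → Circle` to a continuous eccentric angle. Injectivity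
makes this angle monotone and forces it to make exactly one turn, so the length is that of the
standard parametrization over one period (`eVariationOn_comp_angle`,
`PlaneEllipse.hasPerimeter_curve`).

For the analytic part, put `Δ = 1 - k ^ 2 * sin φ ^ 2` with `k = sin (π / 12)`, so that
`k ^ 2 = (2 - √3) / 4`. The function `y = (1 - cos φ) / D` with
`D = (1 + √3) + (√3 - 1) * cos φ` increases from `0` to `1` on `[0, π]` and satisfies
`√3 * Δ * y' ^ 2 = y * (1 - y ^ 3)` (`SingularModulus.cubicParam_deriv_sq`). Hence `t = y ^ 3` turns
`B(1/6, 1/2)` and `B(5/6, 1/2)` into multiples of `∫ 1 / √Δ` and `∫ y ^ 2 / √Δ` over `[0, π]`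
(`SingularModulus.beta_eq_integral`). The derivative of `√Δ * sin φ / D` is a linear combination of
`√Δ`, `1 / √Δ` and `y ^ 2 / √Δ`, which expresses `∫ √Δ` through these two integrals
(`SingularModulus.integral_sqrt_delta`). The reflection formula for the gamma function then gives
the closed form.
-/

open MeasureTheory Set Filter Topology

/-! ### The length of a continuously differentiable curve -/

theorem eVariationOn_Icc_le_of_hasDerivAt {E : Type*} [NormedAddCommGroup E] [NormedSpace ℝ E]
    [CompleteSpace E] {c c' : ℝ → E} (hc : ∀ x, HasDerivAt c (c' x) x) (hc' : Continuous c')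
    (a b : ℝ) :
    eVariationOn c (Icc a b) ≤ ENNReal.ofReal (∫ x in a..b, ‖c' x‖) := by
  have hint : ∀ x y, IntervalIntegrable (fun x => ‖c' x‖) volume x y := fun x y =>
    hc'.norm.intervalIntegrable x y
  have hG : Monotone fun x => ∫ t in a..x, ‖c' t‖ := fun x y hxy => by
    have := intervalIntegral.integral_add_adjacent_intervals (hint a x) (hint x y)
    have h0 : 0 ≤ ∫ t in x..y, ‖c' t‖ :=
      intervalIntegral.integral_nonneg hxy fun _ _ => norm_nonneg _
    simp only; linarith
  have hle : ∀ x ∈ Icc a b, ∀ y ∈ Icc a b, x ≤ y →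
      edist (c y) (c x) ≤ ENNReal.ofReal ((∫ t in a..y, ‖c' t‖) - ∫ t in a..x, ‖c' t‖) := by
    intro x _ y _ hxy
    rw [edist_dist, dist_eq_norm]
    apply ENNReal.ofReal_le_ofReal
    rw [intervalIntegral.integral_interval_sub_left (hint a y) (hint a x),
      ← intervalIntegral.integral_eq_sub_of_hasDerivAt (fun t _ => hc t)
        (hc'.intervalIntegrable x y)]
    exact intervalIntegral.norm_integral_le_integral_norm hxy
  refine iSup_le fun p => ?_
  obtain ⟨n, u, hu, hmem⟩ := p
  calc ∑ i ∈ Finset.range n, edist (c (u (i + 1))) (c (u i))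
      ≤ ∑ i ∈ Finset.range n, ENNReal.ofReal
          ((∫ t in a..u (i + 1), ‖c' t‖) - ∫ t in a..u i, ‖c' t‖) :=
        Finset.sum_le_sum fun i _ => hle _ (hmem i) _ (hmem (i + 1)) (hu i.le_succ)
    _ = ENNReal.ofReal ((∫ t in a..u n, ‖c' t‖) - ∫ t in a..u 0, ‖c' t‖) := by
        rw [← ENNReal.ofReal_sum_of_nonneg fun i _ => sub_nonneg.2 (hG (hu i.le_succ)),
          Finset.sum_range_sub fun i => ∫ t in a..u i, ‖c' t‖]
    _ ≤ ENNReal.ofReal (∫ x in a..b, ‖c' x‖) := by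
        apply ENNReal.ofReal_le_ofReal
        have h1 := hG (hmem n).2
        have h2 : 0 ≤ ∫ t in a..u 0, ‖c' t‖ :=
          intervalIntegral.integral_nonneg (hmem 0).1 fun _ _ => norm_nonneg _
        simp only at h1
        linarith

/-- The length of a continuously differentiable curve is the integral of its speed. For the lower
bound, the amount by which `∫ ‖c'‖` exceeds the variation on `[a, x]` is shown to have
right derivative zero in `x`: its increments are nonnegative, and at most the excess of the
integral of the speed over the length of the chord. -/
theorem eVariationOn_Icc_eq_of_hasDerivAt {E : Type*} [NormedAddCommGroup E] [NormedSpace ℝ E]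
    [CompleteSpace E] {c c' : ℝ → E} (hc : ∀ x, HasDerivAt c (c' x) x) (hc' : Continuous c')
    {a b : ℝ} (hab : a ≤ b) :
    eVariationOn c (Icc a b) = ENNReal.ofReal (∫ x in a..b, ‖c' x‖) := by
  have hint : ∀ x y, IntervalIntegrable (fun x => ‖c' x‖) volume x y := fun x y =>
    hc'.norm.intervalIntegrable x y
  have hfin : ∀ x y : ℝ, eVariationOn c (Icc x y) ≠ ⊤ := fun x y =>
    ne_top_of_le_ne_top ENNReal.ofReal_ne_top (eVariationOn_Icc_le_of_hasDerivAt hc hc' x y)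
  set G : ℝ → ℝ := fun x => ∫ t in a..x, ‖c' t‖ with hG
  set V : ℝ → ℝ := fun x => (eVariationOn c (Icc a x)).toReal with hV
  have hGd : ∀ x, HasDerivAt G ‖c' x‖ x := fun x => hc'.norm.integral_hasStrictDerivAt a x
    |>.hasDerivAt
  have hVadd : ∀ {x y}, a ≤ x → x ≤ y → V y - V x = (eVariationOn c (Icc x y)).toReal := by
    intro x y hx hxy
    have h := eVariationOn.Icc_add_Icc c (s := univ) hx hxy (mem_univ x)
    simp only [univ_inter] at h
    simp only [hV]
    rw [← h, ENNReal.toReal_add (hfin a x) (hfin x y)]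
    ring
  have hupper : ∀ {x y}, a ≤ x → x ≤ y → V y - V x ≤ G y - G x := by
    intro x y hx hxy
    rw [hVadd hx hxy, hG, intervalIntegral.integral_interval_sub_left (hint a y) (hint a x)]
    exact ENNReal.toReal_le_of_le_ofReal
      (intervalIntegral.integral_nonneg hxy fun _ _ => norm_nonneg _)
      (eVariationOn_Icc_le_of_hasDerivAt hc hc' x y)
  have hlower : ∀ {x y}, a ≤ x → x ≤ y → ‖c y - c x‖ ≤ V y - V x := by
    intro x y hx hxy
    rw [hVadd hx hxy, ← dist_eq_norm, dist_edist]
    exact ENNReal.toReal_mono (hfin x y)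
      (eVariationOn.edist_le c (right_mem_Icc.2 hxy) (left_mem_Icc.2 hxy))
  have hderiv : ∀ x ∈ Ico a b, HasDerivWithinAt (fun x => G x - V x) 0 (Ici x) x := by
    intro x hx
    rw [← hasDerivWithinAt_Ioi_iff_Ici, hasDerivWithinAt_iff_tendsto_slope' (by simp)]
    have h1 := (hasDerivWithinAt_iff_tendsto_slope' (lt_irrefl x)).1
      ((hGd x).hasDerivWithinAt (s := Ioi x))
    have h2 := ((hasDerivWithinAt_iff_tendsto_slope' (lt_irrefl x)).1
      ((hc x).hasDerivWithinAt (s := Ioi x))).norm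
    have h3 := h1.sub h2
    rw [sub_self] at h3
    refine tendsto_of_tendsto_of_tendsto_of_le_of_le' tendsto_const_nhds h3 ?_ ?_
    · filter_upwards [self_mem_nhdsWithin] with y hy
      have := hupper hx.1 (le_of_lt hy)
      rw [slope_def_field]
      exact div_nonneg (by linarith) (sub_nonneg.2 (le_of_lt hy))
    · filter_upwards [self_mem_nhdsWithin] with y hy
      have h := hlower hx.1 (le_of_lt hy)
      have hpos : 0 < y - x := sub_pos.2 hy
      rw [slope_def_field, slope_def_field, slope_def_module, norm_smul, norm_inv,
        Real.norm_of_nonneg hpos.le, inv_mul_eq_div, ← sub_div]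
      exact div_le_div_of_nonneg_right (by linarith) hpos.le
  have hGc : Continuous G := continuous_iff_continuousAt.2 fun x => (hGd x).continuousAt
  have hVcont : ContinuousOn V (Icc a b) := by
    have hsub : ∀ x ∈ Icc a b, ∀ y ∈ Icc a b, dist (V y) (V x) ≤ dist (G y) (G x) := by
      have key : ∀ {x y}, a ≤ x → x ≤ y → dist (V y) (V x) ≤ dist (G y) (G x) := by
        intro x y hx hxy
        have h0 := (norm_nonneg _).trans (hlower hx hxy)
        rw [Real.dist_eq, Real.dist_eq, abs_of_nonneg h0]
        exact (hupper hx hxy).trans (le_abs_self _)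
      intro x hx y hy
      rcases le_total x y with h | h
      · exact key hx.1 h
      · rw [dist_comm, dist_comm (G y)]
        exact key hy.1 h
    intro x hx
    refine tendsto_iff_dist_tendsto_zero.2 (squeeze_zero' (.of_forall fun _ => dist_nonneg) ?_
      (tendsto_iff_dist_tendsto_zero.1 (hGc.continuousWithinAt (s := Icc a b) (x := x))))
    filter_upwards [self_mem_nhdsWithin] with y hy using hsub x hx y hy
  have h := constant_of_has_deriv_right_zero (hGc.continuousOn.sub hVcont) hderiv b
    (right_mem_Icc.2 hab)
  have hGa : G a = 0 := intervalIntegral.integral_same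
  have hVa : V a = 0 := by simp [hV, eVariationOn.subsingleton]
  change G b - V b = G a - V a at h
  have : V b = ∫ x in a..b, ‖c' x‖ := by
    rw [hGa, hVa, sub_zero, sub_eq_zero] at h
    exact h.symm
  rw [← this, hV, ENNReal.ofReal_toReal (hfin a b)]

/-! ### Simple closed curves and continuous angles -/

theorem MonotoneOn.Icc_of_Ioo {f : ℝ → ℝ} {a b : ℝ} (hab : a < b) (h : MonotoneOn f (Ioo a b))
    (hf : ContinuousOn f (Icc a b)) : MonotoneOn f (Icc a b) := by
  have h1 : MonotoneOn f (Ico a b) := by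
    rw [← Ioo_insert_left hab]
    refine h.insert_of_continuousWithinAt ?_
      ((hf a (left_mem_Icc.2 hab.le)).mono Ioo_subset_Icc_self)
    rw [← mem_closure_iff_clusterPt, closure_Ioo hab.ne]
    exact left_mem_Icc.2 hab.le
  rw [← Ico_insert_right hab.le]
  refine h1.insert_of_continuousWithinAt ?_
    ((hf b (right_mem_Icc.2 hab.le)).mono Ico_subset_Icc_self)
  rw [← mem_closure_iff_clusterPt, closure_Ico hab.ne]
  exact right_mem_Icc.2 hab.le

theorem Circle.exp_eq_exp_iff_cos_sin {x y : ℝ} :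
    Circle.exp x = Circle.exp y ↔ Real.cos x = Real.cos y ∧ Real.sin x = Real.sin y := by
  rw [Circle.ext_iff, Circle.coe_exp, Circle.coe_exp, Complex.ext_iff,
    Complex.exp_ofReal_mul_I_re, Complex.exp_ofReal_mul_I_re,
    Complex.exp_ofReal_mul_I_im, Complex.exp_ofReal_mul_I_im]

/-- A path on the unit circle, given by its coordinates, has a continuous angle: it is lifted along
the covering map `Circle.exp`. -/
theorem exists_continuousOn_angle {f g : ℝ → ℝ} (hf : ContinuousOn f (Icc 0 1))
    (hg : ContinuousOn g (Icc 0 1)) (h : ∀ t ∈ Icc (0 : ℝ) 1, f t ^ 2 + g t ^ 2 = 1) :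
    ∃ θ : ℝ → ℝ, ContinuousOn θ (Icc 0 1) ∧
      ∀ t ∈ Icc (0 : ℝ) 1, Real.cos (θ t) = f t ∧ Real.sin (θ t) = g t := by
  have hmem : ∀ t : unitInterval, (⟨f t, g t⟩ : ℂ) ∈ Submonoid.unitSphere ℂ := fun t => by
    rw [← SetLike.mem_coe, Submonoid.coe_unitSphere, mem_sphere_zero_iff_norm,
      ← sq_eq_sq₀ (norm_nonneg _) zero_le_one, Complex.sq_norm, Complex.normSq_mk]
    linarith [h t t.2]
  have hcont : Continuous fun t : unitInterval => (⟨f t, g t⟩ : ℂ) := by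
    have h1 := continuousOn_iff_continuous_domRestrict.1 hf
    have h2 := continuousOn_iff_continuous_domRestrict.1 hg
    exact Complex.equivRealProdCLM.symm.continuous.comp (h1.prodMk h2)
  let p : C(unitInterval, Circle) := ⟨fun t => ⟨_, hmem t⟩, hcont.subtype_mk _⟩
  obtain ⟨Γ, hΓ, -⟩ := Circle.isCoveringMap_exp.exists_path_lifts p (Complex.arg (p 0))
    (Circle.exp_arg _).symm
  refine ⟨IccExtend zero_le_one Γ, Γ.continuous.Icc_extend'.continuousOn, fun t ht => ?_⟩
  have h1 := congrArg (fun z : Circle => (z : ℂ)) (congrFun hΓ ⟨t, ht⟩)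
  simp only [Function.comp_apply, Circle.coe_exp] at h1
  rw [IccExtend_of_mem _ _ ht]
  constructor
  · exact (Complex.exp_ofReal_mul_I_re _).symm.trans (congrArg Complex.re h1)
  · exact (Complex.exp_ofReal_mul_I_im _).symm.trans (congrArg Complex.im h1)

/-- An increasing angle that runs through the circle once, back to its starting point, covers an
interval of length `2π`. -/
theorem image_Icc_of_monotoneOn_angle {θ : ℝ → ℝ} (hθ : ContinuousOn θ (Icc 0 1))
    (hmono : StrictMonoOn θ (Ioo 0 1)) (hinj : InjOn (fun t => Circle.exp (θ t)) (Ico 0 1))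
    (hend : Circle.exp (θ 1) = Circle.exp (θ 0)) :
    MonotoneOn θ (Icc 0 1) ∧ θ '' Icc 0 1 = Icc (θ 0) (θ 0 + 2 * Real.pi) := by
  have hm := hmono.monotoneOn.Icc_of_Ioo one_pos hθ
  refine ⟨hm, ?_⟩
  have hlt : θ 0 < θ 1 := by
    have h1 : θ 0 ≤ θ (1 / 3) := hm (by norm_num) (by norm_num) (by norm_num)
    have h2 : θ (1 / 3) < θ (2 / 3) := hmono (by norm_num) (by norm_num) (by norm_num)
    have h3 : θ (2 / 3) ≤ θ 1 := hm (by norm_num) (by norm_num) (by norm_num)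
    linarith
  obtain ⟨m, h1⟩ := Circle.exp_eq_exp.1 hend
  have hpi := Real.pi_pos
  have hm0 : 0 < m := by
    have : (0 : ℝ) < m := by
      by_contra hneg
      nlinarith [not_lt.1 hneg]
    exact_mod_cast this
  have hm2 : m < 2 := by
    by_contra! hge
    have hge' : (2 : ℝ) ≤ m := by exact_mod_cast hge
    have h4 : θ 0 + 4 * Real.pi ≤ θ 1 := by nlinarith
    -- a further turn would meet the starting point at an interior time
    obtain ⟨t, ht, hteq⟩ := intermediate_value_Icc zero_le_one hθ
      (show θ 0 + 2 * Real.pi ∈ Icc (θ 0) (θ 1) from ⟨by linarith, by linarith⟩)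
    have ht1 : t ≠ 1 := by rintro rfl; linarith
    have ht0 : t = 0 := hinj ⟨ht.1, lt_of_le_of_ne ht.2 ht1⟩ (left_mem_Ico.2 one_pos)
      (by simp only [hteq]; exact Circle.periodic_exp _)
    rw [ht0] at hteq
    linarith
  obtain rfl : m = 1 := by omega
  rw [hθ.image_Icc_of_monotoneOn zero_le_one hm, h1, Int.cast_one, one_mul]

/-- The arc length of a closed curve traversed once does not depend on the parametrization: a
continuous angle `θ` that runs through the circle once is monotone, in one direction or the other,
and covers an interval of length `2π`. -/
theorem eVariationOn_comp_angle {E : Type*} [NormedAddCommGroup E] [NormedSpace ℝ E]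
    [CompleteSpace E] {c c' : ℝ → E} (hc : ∀ x, HasDerivAt c (c' x) x) (hc' : Continuous c')
    (hper : Function.Periodic c' (2 * Real.pi))
    {θ : ℝ → ℝ} (hθ : ContinuousOn θ (Icc 0 1))
    (hinj : InjOn (fun t => Circle.exp (θ t)) (Ico 0 1))
    (hend : Circle.exp (θ 1) = Circle.exp (θ 0)) :
    eVariationOn (c ∘ θ) (Icc 0 1) = ENNReal.ofReal (∫ x in 0..2 * Real.pi, ‖c' x‖) := by
  have hlen : ∀ x y, y = x + 2 * Real.pi → eVariationOn c (Icc x y) =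
      ENNReal.ofReal (∫ x in 0..2 * Real.pi, ‖c' x‖) := by
    rintro x y rfl
    have hp : Function.Periodic (fun x => ‖c' x‖) (2 * Real.pi) := hper.comp norm
    rw [eVariationOn_Icc_eq_of_hasDerivAt hc hc' (by linarith [Real.pi_pos]),
      hp.intervalIntegral_add_eq x 0, zero_add]
  have hinjθ : InjOn θ (Ioo 0 1) := fun x hx y hy hxy =>
    hinj (Ioo_subset_Ico_self hx) (Ioo_subset_Ico_self hy) (congrArg Circle.exp hxy)
  rcases (hθ.mono Ioo_subset_Icc_self).strictMonoOn_of_injOn_Ioo one_pos hinjθ with h | h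
  · obtain ⟨hm, him⟩ := image_Icc_of_monotoneOn_angle hθ h hinj hend
    rw [eVariationOn.comp_eq_of_monotoneOn _ _ hm, him]
    exact hlen _ _ rfl
  · obtain ⟨hm, him⟩ := image_Icc_of_monotoneOn_angle (θ := fun t => -θ t) hθ.neg h.neg
      (fun x hx y hy hxy => hinj hx hy (by simpa [Circle.exp_neg] using hxy))
      (by simp [Circle.exp_neg, hend])
    have hanti : AntitoneOn θ (Icc 0 1) := by simpa using hm.neg
    have him' : θ '' Icc 0 1 = Icc (θ 0 - 2 * Real.pi) (θ 0) := by
      have := congrArg (image Neg.neg) him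
      rw [image_image, image_neg_Icc] at this
      simpa [sub_eq_add_neg, add_comm] using this
    rw [eVariationOn.comp_eq_of_antitoneOn _ _ hanti, him']
    exact hlen _ _ (by ring)

/-! ### The perimeter of an ellipse -/

namespace PlaneEllipse

variable (E : PlaneEllipse)

theorem semimajor_pos : 0 < E.semimajor := E.semiminor_pos.trans_le E.semiminor_le

/-- The parametrization of the ellipse by the eccentric angle, measured from the minor axis, so that
the speed is the usual integrand `a * √(1 - e ^ 2 * sin t ^ 2)` of an elliptic integral. -/
noncomputable def param (t : ℝ) : EuclideanPlane :=
  E.center + E.axes.repr.symm !₂[E.semimajor * Real.sin t, E.semiminor * Real.cos t]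

/-- The velocity of `PlaneEllipse.param`. -/
noncomputable def velocity (t : ℝ) : EuclideanPlane :=
  E.axes.repr.symm !₂[E.semimajor * Real.cos t, -(E.semiminor * Real.sin t)]

theorem hasDerivAt_param (t : ℝ) : HasDerivAt E.param (E.velocity t) t := by
  have h : HasDerivAt (fun t => !₂[E.semimajor * Real.sin t, E.semiminor * Real.cos t])
      !₂[E.semimajor * Real.cos t, -(E.semiminor * Real.sin t)] t := by
    have h' : HasDerivAt (fun t => ![E.semimajor * Real.sin t, E.semiminor * Real.cos t])
        ![E.semimajor * Real.cos t, -(E.semiminor * Real.sin t)] t := by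
      refine hasDerivAt_pi.2 fun i => ?_
      fin_cases i
      · simpa using (Real.hasDerivAt_sin t).const_mul E.semimajor
      · simpa using (Real.hasDerivAt_cos t).const_mul E.semiminor
    exact (PiLp.hasFDerivAt_toLp (𝕜 := ℝ) 2 _).comp_hasDerivAt t h'
  exact (E.axes.repr.symm.toContinuousLinearEquiv.hasFDerivAt.comp_hasDerivAt t h).const_add _

theorem continuous_velocity : Continuous E.velocity := by
  refine E.axes.repr.symm.continuous.comp ((PiLp.continuous_toLp 2 _).comp ?_)
  refine continuous_pi fun i => ?_
  fin_cases i <;> simp <;> fun_prop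

theorem continuous_param : Continuous E.param :=
  continuous_iff_continuousAt.2 fun t => (E.hasDerivAt_param t).continuousAt

theorem periodic_velocity : Function.Periodic E.velocity (2 * Real.pi) := fun t => by
  simp only [velocity, Real.sin_add_two_pi, Real.cos_add_two_pi]

theorem norm_velocity (t : ℝ) : ‖E.velocity t‖ =
    E.semimajor * √(1 - E.eccentricity ^ 2 * Real.sin t ^ 2) := by
  have ha := E.semimajor_pos
  have he : E.eccentricity ^ 2 = 1 - E.semiminor ^ 2 / E.semimajor ^ 2 := by
    refine Real.sq_sqrt (sub_nonneg.2 ((div_le_one (by positivity)).2 ?_))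
    exact pow_le_pow_left₀ E.semiminor_pos.le E.semiminor_le 2
  rw [velocity, LinearIsometryEquiv.norm_map, EuclideanSpace.norm_eq]
  simp only [Fin.sum_univ_two, Real.norm_eq_abs, sq_abs]
  rw [← Real.sqrt_sq ha.le, ← Real.sqrt_mul (sq_nonneg _), he, Real.sqrt_sq ha.le]
  congr 1
  simp only [Matrix.cons_val_zero, Matrix.cons_val_one, Matrix.cons_val_fin_one]
  have hb : E.semimajor ^ 2 * (E.semiminor ^ 2 / E.semimajor ^ 2) = E.semiminor ^ 2 := by
    field_simp
  linear_combination E.semimajor ^ 2 * Real.cos_sq_add_sin_sq t - Real.sin t ^ 2 * hb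

theorem mem_curve_iff {P : EuclideanPlane} : P ∈ E.curve ↔
    (E.axes.repr (P - E.center) 1 / E.semiminor) ^ 2 +
      (E.axes.repr (P - E.center) 0 / E.semimajor) ^ 2 = 1 := by
  rw [curve, mem_ofPred_eq, div_pow, div_pow, add_comm]

theorem eq_param_iff {P : EuclideanPlane} {t : ℝ} : P = E.param t ↔
    Real.cos t = E.axes.repr (P - E.center) 1 / E.semiminor ∧
      Real.sin t = E.axes.repr (P - E.center) 0 / E.semimajor := by
  rw [param, ← sub_eq_iff_eq_add', ← LinearIsometryEquiv.symm_apply_eq,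
    LinearIsometryEquiv.symm_symm, eq_div_iff E.semiminor_pos.ne', eq_div_iff E.semimajor_pos.ne']
  constructor
  · intro h
    simp [h, mul_comm]
  · rintro ⟨h1, h2⟩
    ext i
    fin_cases i
    · exact h2.symm.trans (mul_comm _ _)
    · exact h1.symm.trans (mul_comm _ _)

theorem param_eq_param_iff {s t : ℝ} : E.param s = E.param t ↔ Circle.exp s = Circle.exp t := by
  obtain ⟨h1, h2⟩ := E.eq_param_iff.1 (rfl : E.param s = E.param s)
  rw [eq_param_iff, ← h1, ← h2, Circle.exp_eq_exp_iff_cos_sin, eq_comm,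
    eq_comm (a := Real.sin t)]

theorem param_mem_curve (t : ℝ) : E.param t ∈ E.curve := by
  obtain ⟨h1, h2⟩ := E.eq_param_iff.1 (rfl : E.param t = E.param t)
  rw [mem_curve_iff, ← h1, ← h2, Real.cos_sq_add_sin_sq]

theorem exists_param_eq {P : EuclideanPlane} (hP : P ∈ E.curve) :
    ∃ t ∈ Ico 0 (2 * Real.pi), E.param t = P := by
  obtain ⟨θ, -, hθ⟩ := exists_continuousOn_angle continuousOn_const continuousOn_const
    fun _ _ => E.mem_curve_iff.1 hP
  have hper : Function.Periodic E.param (2 * Real.pi) := fun t =>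
    E.param_eq_param_iff.2 (Circle.periodic_exp t)
  obtain ⟨t, ht, h⟩ := hper.exists_mem_Ico₀ Real.two_pi_pos (θ 0)
  exact ⟨t, ht, h.symm.trans (E.eq_param_iff.2 (hθ 0 (by simp))).symm⟩

theorem isSimpleClosedParam_param :
    IsSimpleClosedParam (fun t => E.param (2 * Real.pi * t)) E.curve where
  continuousOn := (E.continuous_param.comp (by fun_prop)).continuousOn
  closed := by
    rw [param_eq_param_iff, mul_zero, mul_one, Circle.exp_two_pi, Circle.exp_zero]
  injOn := by
    intro s hs t ht h
    obtain ⟨m, hm⟩ := Circle.exp_eq_exp.1 (E.param_eq_param_iff.1 h)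
    have hst : s = t + m := by
      apply mul_left_cancel₀ Real.two_pi_pos.ne'
      linarith
    have h1 : (m : ℝ) < 1 := by linarith [hs.2, ht.1]
    have h2 : (-1 : ℝ) < m := by linarith [hs.1, ht.2]
    have hm0 : m = 0 := by
      have h1' : m < 1 := by exact_mod_cast h1
      have h2' : -1 < m := by exact_mod_cast h2
      omega
    simpa [hm0] using hst
  image_eq := by
    ext P
    constructor
    · rintro ⟨t, -, rfl⟩
      exact E.param_mem_curve _
    · intro hP
      obtain ⟨t, ht, rfl⟩ := E.exists_param_eq hP
      have := Real.two_pi_pos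
      refine ⟨t / (2 * Real.pi), ⟨div_nonneg ht.1 this.le, (div_le_one this).2 ht.2.le⟩, ?_⟩
      simp only [mul_div_cancel₀ t this.ne']

/-- The perimeter of an arbitrary ellipse as an elliptic integral. -/
theorem hasPerimeter_curve : HasPerimeter E.curve
    (∫ t in 0..2 * Real.pi, E.semimajor * √(1 - E.eccentricity ^ 2 * Real.sin t ^ 2)) := by
  refine ⟨⟨_, E.isSimpleClosedParam_param⟩, fun γ hγ => ?_⟩
  have hmem : ∀ t ∈ Icc (0 : ℝ) 1, γ t ∈ E.curve := fun t ht => hγ.image_eq ▸ mem_image_of_mem γ ht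
  have hcoord : ∀ i, ContinuousOn (fun t => E.axes.repr (γ t - E.center) i) (Icc 0 1) := fun i =>
    (EuclideanSpace.proj i : EuclideanPlane →L[ℝ] ℝ).continuous.comp_continuousOn
      (E.axes.repr.continuous.comp_continuousOn (hγ.continuousOn.sub continuousOn_const))
  obtain ⟨θ, hθ, hθγ⟩ := exists_continuousOn_angle ((hcoord 1).div_const E.semiminor)
    ((hcoord 0).div_const E.semimajor) fun t ht => E.mem_curve_iff.1 (hmem t ht)
  have heq : ∀ t ∈ Icc (0 : ℝ) 1, γ t = E.param (θ t) := fun t ht => E.eq_param_iff.2 (hθγ t ht)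
  have h := eVariationOn_comp_angle E.hasDerivAt_param E.continuous_velocity E.periodic_velocity hθ
    (fun s hs t ht hst => hγ.injOn hs ht (by
      rw [heq s (Ico_subset_Icc_self hs), heq t (Ico_subset_Icc_self ht)]
      exact E.param_eq_param_iff.2 hst))
    (by rw [← E.param_eq_param_iff, ← heq 1 (by simp), ← heq 0 (by simp), hγ.closed])
  rw [← eVariationOn.congr (show EqOn γ (E.param ∘ θ) (Icc 0 1) from heq)] at h
  simp only [norm_velocity] at h
  rw [h]
  refine ⟨ENNReal.ofReal_ne_top, ENNReal.toReal_ofReal ?_⟩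
  exact intervalIntegral.integral_nonneg Real.two_pi_pos.le fun t _ =>
    mul_nonneg E.semimajor_pos.le (Real.sqrt_nonneg _)

end PlaneEllipse

/-! ### The elliptic integrals with modulus `sin (π / 12)` -/

/-- The beta function as a real integral over the open unit interval. -/
theorem beta_eq_setIntegral {u v : ℝ} (hu : 0 < u) (hv : 0 < v) :
    ProbabilityTheory.beta u v = ∫ t in Ioo (0 : ℝ) 1, t ^ (u - 1) * (1 - t) ^ (v - 1) := by
  rw [ProbabilityTheory.beta_eq_betaIntegralReal u v hu hv, Complex.betaIntegral,
    intervalIntegral.integral_of_le zero_le_one, integral_Ioc_eq_integral_Ioo]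
  have h : ∫ x in Ioo (0 : ℝ) 1, (x : ℂ) ^ ((u : ℂ) - 1) * (1 - (x : ℂ)) ^ ((v : ℂ) - 1) =
      ∫ x in Ioo (0 : ℝ) 1, ((x ^ (u - 1) * (1 - x) ^ (v - 1) : ℝ) : ℂ) := by
    refine setIntegral_congr_fun measurableSet_Ioo fun x hx => ?_
    simp only [Complex.ofReal_mul]
    rw [Complex.ofReal_cpow hx.1.le, Complex.ofReal_cpow (sub_nonneg.2 hx.2.le)]
    push_cast
    rfl
  rw [h, integral_complex_ofReal, Complex.ofReal_re]

namespace SingularModulus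

/-- The integrand `1 - k ^ 2 * sin φ ^ 2` of the elliptic integrals, for the modulus
`k = sin (π / 12)`. -/
noncomputable def delta (φ : ℝ) : ℝ := 1 - (2 - √3) / 4 * Real.sin φ ^ 2

/-- The denominator of `cubicParam`; up to a constant factor, `cubicParam' = sin / denom ^ 2`. -/
noncomputable def denom (φ : ℝ) : ℝ := (1 + √3) + (√3 - 1) * Real.cos φ

/-- The substitution that takes the elliptic integral of the first kind with modulus `sin (π / 12)`
to `∫ dy / √(y * (1 - y ^ 3))`; it increases from `0` to `1` on `[0, π]`. -/
noncomputable def cubicParam (φ : ℝ) : ℝ := (1 - Real.cos φ) / denom φ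

theorem sq_sqrt_three : √3 ^ 2 = (3 : ℝ) := Real.sq_sqrt (by norm_num)

theorem one_lt_sqrt_three : 1 < √(3 : ℝ) := by
  rw [Real.lt_sqrt] <;> norm_num

theorem sqrt_three_lt_two : √(3 : ℝ) < 2 := by
  rw [Real.sqrt_lt'] <;> norm_num

theorem delta_pos (φ : ℝ) : 0 < delta φ := by
  have h1 := one_lt_sqrt_three
  have h2 := sqrt_three_lt_two
  have h3 := Real.sin_sq_le_one φ
  unfold delta
  nlinarith [sq_nonneg (Real.sin φ)]

theorem denom_pos (φ : ℝ) : 0 < denom φ := by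
  have h1 := one_lt_sqrt_three
  have h2 := Real.neg_one_le_cos φ
  unfold denom
  nlinarith

theorem continuous_delta : Continuous delta := by unfold delta; fun_prop

theorem hasDerivAt_delta (φ : ℝ) :
    HasDerivAt delta (-((2 - √3) / 4 * (2 * Real.sin φ * Real.cos φ))) φ := by
  have h := (((Real.hasDerivAt_sin φ).pow 2).const_mul ((2 - √3) / 4)).const_sub 1
  exact h.congr_deriv (by simp)

theorem hasDerivAt_denom (φ : ℝ) : HasDerivAt denom (-((√3 - 1) * Real.sin φ)) φ := by
  exact (((Real.hasDerivAt_cos φ).const_mul (√3 - 1)).const_add (1 + √3)).congr_deriv (by ring)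

theorem hasDerivAt_cubicParam (φ : ℝ) :
    HasDerivAt cubicParam (2 * √3 * Real.sin φ / denom φ ^ 2) φ := by
  have h := ((Real.hasDerivAt_cos φ).const_sub 1).div (hasDerivAt_denom φ) (denom_pos φ).ne'
  refine h.congr_deriv ?_
  congr 1
  unfold denom
  ring

theorem continuous_cubicParam : Continuous cubicParam :=
  continuous_iff_continuousAt.2 fun φ => (hasDerivAt_cubicParam φ).continuousAt

/-- The differential equation `√3 * delta * y' ^ 2 = y * (1 - y ^ 3)` for `y = cubicParam`, which
is what singles out the modulus `sin (π / 12)`. -/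
theorem cubicParam_deriv_sq (φ : ℝ) :
    √3 * delta φ * (2 * √3 * Real.sin φ / denom φ ^ 2) ^ 2 =
      cubicParam φ * (1 - cubicParam φ ^ 3) := by
  have hD := (denom_pos φ).ne'
  have hq := sq_sqrt_three
  have hs : Real.sin φ ^ 2 = 1 - Real.cos φ ^ 2 := Real.sin_sq φ
  rw [cubicParam]
  field_simp
  have h1 : √3 ^ 3 * 2 ^ 2 * delta φ * Real.sin φ ^ 2 =
      (1 - Real.cos φ) * (12 * √3 * delta φ * (1 + Real.cos φ)) := by
    rw [hs]
    linear_combination 4 * √3 * delta φ * (1 - Real.cos φ ^ 2) * hq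
  have h2 : 12 * √3 * delta φ * (1 + Real.cos φ) = denom φ ^ 3 - (1 - Real.cos φ) ^ 3 := by
    unfold delta denom
    rw [hs]
    linear_combination -(√3 * (1 + Real.cos φ) ^ 3) * hq
  linear_combination h1 + (1 - Real.cos φ) * h2

theorem cubicParam_deriv_pos {φ : ℝ} (hφ : φ ∈ Ioo 0 Real.pi) :
    0 < 2 * √3 * Real.sin φ / denom φ ^ 2 := by
  have := Real.sin_pos_of_mem_Ioo hφ
  have := denom_pos φ
  positivity

theorem strictMonoOn_cubicParam : StrictMonoOn cubicParam (Icc 0 Real.pi) := by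
  refine strictMonoOn_of_deriv_pos (convex_Icc _ _) continuous_cubicParam.continuousOn fun φ hφ => ?_
  rw [interior_Icc] at hφ
  rw [(hasDerivAt_cubicParam φ).deriv]
  exact cubicParam_deriv_pos hφ

theorem cubicParam_zero : cubicParam 0 = 0 := by simp [cubicParam]

theorem cubicParam_pi : cubicParam Real.pi = 1 := by
  norm_num [cubicParam, denom]

theorem cubicParam_mem_Ioo {φ : ℝ} (hφ : φ ∈ Ioo 0 Real.pi) : cubicParam φ ∈ Ioo 0 1 := by
  have h := strictMonoOn_cubicParam.mapsTo_Ioo hφ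
  rwa [cubicParam_zero, cubicParam_pi] at h

/-- The substitution `t = cubicParam φ ^ 3` in the beta integral: the exponents are chosen such that
the integrand becomes `y ^ j * y' / √(y * (1 - y ^ 3))`, to which `cubicParam_deriv_sq` applies. -/
theorem beta_eq_integral (j : ℕ) :
    ProbabilityTheory.beta (1 / 6 + j / 3) (1 / 2) =
      3 / √(√3) * ∫ φ in 0..Real.pi, cubicParam φ ^ j / √(delta φ) := by
  have hmono : StrictMonoOn (fun φ => cubicParam φ ^ 3) (Icc 0 Real.pi) := by
    intro x hx y hy hxy
    exact pow_lt_pow_left₀ (strictMonoOn_cubicParam hx hy hxy)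
      (cubicParam_zero ▸ strictMonoOn_cubicParam.monotoneOn (left_mem_Icc.2 Real.pi_pos.le) hx hx.1)
      three_ne_zero
  have him : (fun φ => cubicParam φ ^ 3) '' Ioo 0 Real.pi = Ioo 0 1 := by
    rw [ContinuousOn.image_Ioo_of_strictMonoOn Real.pi_pos.le
      (by exact (continuous_cubicParam.pow 3).continuousOn) hmono]
    simp [cubicParam_zero, cubicParam_pi]
  rw [beta_eq_setIntegral (by positivity) (by norm_num), ← him,
    integral_image_eq_integral_abs_deriv_smul (f := fun φ => cubicParam φ ^ 3) measurableSet_Ioo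
      (fun φ _ => ((hasDerivAt_cubicParam φ).pow 3).hasDerivWithinAt)
      (hmono.injOn.mono Ioo_subset_Icc_self),
    intervalIntegral.integral_of_le Real.pi_pos.le, integral_Ioc_eq_integral_Ioo,
    ← integral_const_mul]
  refine setIntegral_congr_fun measurableSet_Ioo fun φ hφ => ?_
  obtain ⟨hy0, hy1⟩ := cubicParam_mem_Ioo hφ
  have hy' := cubicParam_deriv_pos hφ
  have hsq := cubicParam_deriv_sq φ
  have hΔ := delta_pos φ
  simp only [smul_eq_mul]
  set y := cubicParam φ
  set y' := 2 * √3 * Real.sin φ / denom φ ^ 2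
  have hz : 0 < 1 - y ^ 3 := sub_pos.2 (pow_lt_one₀ hy0.le hy1 three_ne_zero)
  have hroot : √y * √(1 - y ^ 3) = √(√3) * √(delta φ) * y' := by
    rw [← Real.sqrt_mul hy0.le, ← hsq, Real.sqrt_mul (by positivity),
      Real.sqrt_mul (by positivity), Real.sqrt_sq hy'.le]
  have hpow : (y ^ 3) ^ ((1 / 6 + j / 3 : ℝ) - 1) = y ^ j * √y / y ^ 3 := by
    rw [← Real.rpow_natCast y 3, ← Real.rpow_mul hy0.le, Real.sqrt_eq_rpow,
      ← Real.rpow_natCast y j, ← Real.rpow_add hy0, ← Real.rpow_sub hy0]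
    congr 1
    push_cast
    ring
  have hpow' : (1 - y ^ 3) ^ ((1 / 2 : ℝ) - 1) = 1 / √(1 - y ^ 3) := by
    rw [Real.sqrt_eq_rpow, one_div ((1 - y ^ 3) ^ (1 / 2 : ℝ)), ← Real.rpow_neg hz.le]
    norm_num
  rw [hpow, hpow', abs_of_pos (by positivity)]
  have hsy : 0 < √y := Real.sqrt_pos.2 hy0
  have hsz : 0 < √(1 - y ^ 3) := Real.sqrt_pos.2 hz
  have hsΔ : 0 < √(delta φ) := Real.sqrt_pos.2 hΔ
  have hr : 0 < √(√3 : ℝ) := by positivity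
  have hyy : √y ^ 2 = y := Real.sq_sqrt hy0.le
  push_cast
  field_simp
  linear_combination -√y * hroot + √(1 - y ^ 3) * hyy

/-- The relation between the elliptic integrals of the second and first kind, from the
antiderivative `√delta * sin / denom`, which vanishes at both ends. -/
theorem integral_sqrt_delta :
    √3 * ∫ φ in 0..Real.pi, √(delta φ) =
      (√3 + 1) / 2 * (∫ φ in 0..Real.pi, cubicParam φ ^ 0 / √(delta φ)) +
        ∫ φ in 0..Real.pi, cubicParam φ ^ 2 / √(delta φ) := by
  have hcont : ∀ j : ℕ, Continuous fun φ => cubicParam φ ^ j / √(delta φ) := fun j =>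
    (continuous_cubicParam.pow j).div (continuous_delta.sqrt) fun φ =>
      (Real.sqrt_pos.2 (delta_pos φ)).ne'
  have hderiv : ∀ φ, HasDerivAt
      (fun φ => √3 * (√3 - 1) * (√(delta φ) * Real.sin φ / denom φ))
      (√3 * √(delta φ) - ((√3 + 1) / 2 * (cubicParam φ ^ 0 / √(delta φ)) +
        cubicParam φ ^ 2 / √(delta φ))) φ := by
    intro φ
    have hD := (denom_pos φ).ne'
    have hΔ := Real.sqrt_pos.2 (delta_pos φ)
    have h := (((((hasDerivAt_delta φ).sqrt (delta_pos φ).ne').mul (Real.hasDerivAt_sin φ)).div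
      (hasDerivAt_denom φ) hD)).const_mul (√3 * (√3 - 1))
    refine h.congr_deriv ?_
    have hs2 : √(delta φ) ^ 2 = delta φ := Real.sq_sqrt (delta_pos φ).le
    rw [cubicParam]
    simp only [Pi.mul_apply]
    field_simp
    rw [hs2]
    have hq := sq_sqrt_three
    have hs : Real.sin φ ^ 2 = 1 - Real.cos φ ^ 2 := Real.sin_sq φ
    unfold delta denom
    rw [hs]
    -- the difference of the two sides, a polynomial in `√3` and `cos φ`, divided by `√3 ^ 2 - 3`
    linear_combination (-4 * √3 + 4 * Real.cos φ ^ 2 * √3 - 4 + 8 * Real.cos φ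
      - 4 * Real.cos φ ^ 2) * hq
  have hint := intervalIntegral.integral_eq_sub_of_hasDerivAt (a := 0) (b := Real.pi)
    (fun φ _ => hderiv φ) (Continuous.intervalIntegrable
      ((continuous_delta.sqrt.const_mul _).sub (((hcont 0).const_mul _).add (hcont 2))) _ _)
  rw [intervalIntegral.integral_sub, intervalIntegral.integral_add,
    intervalIntegral.integral_const_mul, intervalIntegral.integral_const_mul] at hint
  · simp only [Real.sin_pi, Real.sin_zero, mul_zero, zero_div, sub_zero] at hint
    exact sub_eq_zero.1 hint
  · exact ((hcont 0).const_mul _).intervalIntegrable _ _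
  · exact (hcont 2).intervalIntegrable _ _
  · exact (continuous_delta.sqrt.const_mul _).intervalIntegrable _ _
  · exact (((hcont 0).const_mul _).add (hcont 2)).intervalIntegrable _ _

/-- The reflection formula at `1 / 6` and at `1 / 3`. -/
theorem Gamma_one_sixth_div_Gamma_two_thirds : Real.Gamma (1 / 6) / Real.Gamma (2 / 3) =
    √3 * (Real.Gamma (1 / 3) / Real.Gamma (5 / 6)) := by
  have h1 := Real.Gamma_mul_Gamma_one_sub (1 / 6)
  have h2 := Real.Gamma_mul_Gamma_one_sub (1 / 3)
  rw [show (1 : ℝ) - 1 / 6 = 5 / 6 by norm_num, show Real.pi * (1 / 6) = Real.pi / 6 by ring,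
    Real.sin_pi_div_six] at h1
  rw [show (1 : ℝ) - 1 / 3 = 2 / 3 by norm_num, show Real.pi * (1 / 3) = Real.pi / 3 by ring,
    Real.sin_pi_div_three] at h2
  have h3 : 0 < Real.Gamma (2 / 3) := Real.Gamma_pos_of_pos (by norm_num)
  have h4 : 0 < Real.Gamma (5 / 6) := Real.Gamma_pos_of_pos (by norm_num)
  have hq := sq_sqrt_three
  have hq0 : 0 < √(3 : ℝ) := by positivity
  rw [← mul_div_assoc, div_eq_div_iff h3.ne' h4.ne', h1, mul_assoc, h2]
  field_simp

/-- The left-hand side is `4 E(k)`, for the complete elliptic integral `E(k)` of the second kind with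
`k = sin (π / 12)`. -/
theorem integral_sqrt_delta_eq :
    2 * ∫ φ in 0..Real.pi, √(delta φ) = √(Real.pi / √3) *
        ((1 + 1 / √3) * (Real.Gamma (1 / 3) / Real.Gamma (5 / 6)) +
          2 * Real.Gamma (5 / 6) / Real.Gamma (1 / 3)) := by
  have h := integral_sqrt_delta
  have h0 := beta_eq_integral 0
  have h2 := beta_eq_integral 2
  have hr : 0 < √(√3 : ℝ) := by positivity
  have hq := sq_sqrt_three
  have hq0 : 0 < √(3 : ℝ) := by positivity
  have hrq : √(√3 : ℝ) ^ 2 = √3 := Real.sq_sqrt hq0.le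
  have h3 : 0 < Real.Gamma (1 / 3) := Real.Gamma_pos_of_pos (by norm_num)
  have h4 : 0 < Real.Gamma (5 / 6) := Real.Gamma_pos_of_pos (by norm_num)
  have hΓ : Real.Gamma (4 / 3) = 1 / 3 * Real.Gamma (1 / 3) := by
    rw [← Real.Gamma_add_one (by norm_num)]
    norm_num
  rw [ProbabilityTheory.beta, show (1 / 6 + (0 : ℕ) / 3 : ℝ) = 1 / 6 by norm_num,
    show (1 / 6 + 1 / 2 : ℝ) = 2 / 3 by norm_num, Real.Gamma_one_half_eq, mul_div_right_comm,
    Gamma_one_sixth_div_Gamma_two_thirds] at h0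
  rw [ProbabilityTheory.beta, show (1 / 6 + (2 : ℕ) / 3 : ℝ) = 5 / 6 by norm_num,
    show (5 / 6 + 1 / 2 : ℝ) = 4 / 3 by norm_num, Real.Gamma_one_half_eq, hΓ] at h2
  rw [Real.sqrt_div Real.pi_pos.le]
  generalize (∫ φ in 0..Real.pi, cubicParam φ ^ 0 / √(delta φ)) = I₀ at *
  generalize (∫ φ in 0..Real.pi, cubicParam φ ^ 2 / √(delta φ)) = I₂ at *
  generalize (∫ φ in 0..Real.pi, √(delta φ)) = J at *
  generalize Real.Gamma (1 / 3) = G at *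
  generalize Real.Gamma (5 / 6) = H at *
  -- all powers of `3` are expressed through `r = 3 ^ (1 / 4)`
  generalize √(√3 : ℝ) = r at *
  rw [← hrq] at h h0 hq ⊢
  have e0 : I₀ = r ^ 3 / 3 * (G / H) * √Real.pi := by
    field_simp at h0 ⊢
    linear_combination -h0
  have e2 : I₂ = r * (H / G) * √Real.pi := by
    field_simp at h2 ⊢
    linear_combination -h2
  have hJ : J = ((r ^ 2 + 1) / 2 * I₀ + I₂) / r ^ 2 := by
    field_simp
    linear_combination 2 * h
  rw [hJ, e0, e2]
  field_simp
  linear_combination (r ^ 2 + 1) * G ^ 2 * hq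

theorem sq_sin_pi_div_twelve : Real.sin (Real.pi / 12) ^ 2 = (2 - √3) / 4 := by
  rw [Real.sin_sq_eq_half_sub, show 2 * (Real.pi / 12) = Real.pi / 6 by ring, Real.cos_pi_div_six]
  ring

theorem integral_sqrt_delta_zero_two_pi :
    ∫ φ in 0..2 * Real.pi, √(delta φ) = 2 * ∫ φ in 0..Real.pi, √(delta φ) := by
  have hper : Function.Periodic (fun φ => √(delta φ)) Real.pi := fun φ => by
    simp only [delta, Real.sin_add_pi, neg_sq]
  have hint : ∀ a b, IntervalIntegrable (fun φ => √(delta φ)) volume a b := fun a b =>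
    continuous_delta.sqrt.intervalIntegrable a b
  rw [← intervalIntegral.integral_add_adjacent_intervals (hint 0 Real.pi) (hint _ _), two_mul,
    hper.intervalIntegral_add_eq Real.pi 0, zero_add, two_mul]

end SingularModulus

theorem mainTheorem4 (E : PlaneEllipse)
    (hE : E.eccentricity = Real.sin (Real.pi / 12)) :
    HasPerimeter E.curve
      (E.semimajor * Real.sqrt (Real.pi / Real.sqrt 3) *
        ((1 + 1 / Real.sqrt 3) * (Real.Gamma (1 / 3) / Real.Gamma (5 / 6)) +
          2 * Real.Gamma (5 / 6) / Real.Gamma (1 / 3))) := by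
  have h := E.hasPerimeter_curve
  rw [hE, SingularModulus.sq_sin_pi_div_twelve, intervalIntegral.integral_const_mul] at h
  change HasPerimeter E.curve
    (E.semimajor * ∫ φ in 0..2 * Real.pi, √(SingularModulus.delta φ)) at h
  rwa [SingularModulus.integral_sqrt_delta_zero_two_pi, SingularModulus.integral_sqrt_delta_eq,
    ← mul_assoc] at h
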